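/- Let $P$ be a free abelian group of finite rank (the coweight lattice) with dual $P^\vee=\mathrm{Hom}(P,\mathbb Z)$, let $I$ be a finite set, and let $(\alpha_i)_{i\in I}\subset P$ (simple coroots) and $(\alpha_i^\vee)_{i\in I}\subset P^\vee$ (simple roots) be such that $(\langle\alpha_i,\alpha_j^\vee\rangle)_{i,j}$ is a generalized Cartan matrix (a Kac–Moody root datum). Assume that the simple roots $\alpha_i^\vee$ are linearly independent and that fundamental weights $\Lambda_i^\vee\in P^\vee$ with $\langle\alpha_j,\Lambda_i^\vee\rangle=\delta_{ij}$ have been chosen; put $\rho^\vee=\sum_i\Lambda_i^\vee$. Let $W\subset GL(P)$ be the Weyl group, generated by $s_i(\mu)=\mu-\langle\mu,\alpha_i^\vee\rangle\alpha_i$; it acts on $P^\vee$ by duality. A real root is a weight $\beta^\vee=w(\alpha_i^\vee)$ with $w\in W$; its coroot is $\beta=w(\alpha_i)$, and $s_\beta(\mu)=\mu-\langle\mu,\beta^\vee\rangle\beta$. A real root is positive (negative) if it (its negative) is a non-negative integral combination of simple roots. For $w \in W$ let $\mathrm{Inv}(w)$ be the set of positive real roots $\gamma^\vee$ with $w(\gamma^\vee)$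 negative. Let $\mathcal T=\bigcup_{w\in W}w(P^{++})$ be the Tits cone, where $P^{++}=\{\lambda\in P:\langle\lambda,\alpha_i^\vee\rangle\ge0\text{ for all }i\in I\}$, and let $\mathcal W_{\mathcal T}=W\ltimes\mathcal T\subset \mathcal W_P=W\ltimes P$, with elements written $\pi^\mu w$. The group $\mathcal W_P$ acts on expressions $\gamma+n\pi$ ($\gamma\in P^\vee$, $n\in\mathbb Z$) by $\pi^\mu w(\gamma+n\pi)=w(\gamma)+(n+\langle\mu,w(\gamma)\rangle)\pi$. A double affine root is $\beta^\vee+n\pi$ with $\beta^\vee$ a real root and $n\in\mathbb Z$; it is positive if $\beta^\vee>0$ and $n\ge0$, or $\beta^\vee<0$ and $n>0$. Its reflection is $s_{\beta^\vee+n\pi}=\pi^{n\beta}s_\beta\in\mathcal W_P$. Define a length $\ell:\mathcal W_{\mathcal T}\to\mathbb Z\oplus\mathbb Z\varepsilon$, the target being ordered lexicographically with $\varepsilon$ infinitesimal, by $$\ell(\pi^\mu w)=2\langle\mu^+,\rho^\vee\rangle+\varepsilon\left(|\{\gamma^\vee\in\mathrm{Inv}(w^{-1}):\langle\mu,\gamma^\vee\rangle\ge0\}|-|\{\gamma^\vee\in\mathrm{Inv}(w^{-1}):\langle\mu,\gamma^\vee\rangle<0\}|\right),$$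 where $\mu^+$ is the dominant element of the orbit $W\mu$. Let $\le$ (the Braverman–Kazhdan–Patnaik preorder) be the preorder on $\mathcal W_{\mathcal T}$ generated by $y\le ys_b$ for all $y\in\mathcal W_{\mathcal T}$ and positive double affine roots $b$ with $ys_b\in\mathcal W_{\mathcal T}$ and $y(b)$ positive. Let $\preceq$ be the preorder on $\mathcal W_{\mathcal T}$ generated by $y\preceq ys_b$ for all $y\in\mathcal W_{\mathcal T}$ and positive double affine roots $b$ with $ys_b\in\mathcal W_{\mathcal T}$ and $\ell(ys_b)>\ell(y)$. Then $\le$ and $\preceq$ coincide. In particular, $\le$ is a partial order. -/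

import Mathlib

/-- A Kac-Moody root datum on a finite-rank lattice `P` (the coweight lattice) with finite index
set `I`. The weight lattice is the dual lattice `Module.Dual ℤ P`, and the pairing `⟨μ, f⟩` of a
coweight `μ` with a weight `f` is the evaluation `f μ`. The last four fields say that the matrix
`⟨αᵢ, αⱼ^∨⟩` is a generalized Cartan matrix. -/
structure KacMoodyRootDatum (P : Type*) [AddCommGroup P] (I : Type*) where
  /-- the simple coroots `αᵢ ∈ P` -/
  simpleCoroot : I → P
  /-- the simple roots `αᵢ^∨ ∈ P^∨` -/
  simpleRoot : I → Module.Dual ℤ P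
  simpleCoroot_injective : Function.Injective simpleCoroot
  simpleRoot_injective : Function.Injective simpleRoot
  pairing_self : ∀ i, simpleRoot i (simpleCoroot i) = 2
  pairing_nonpos : ∀ i j, i ≠ j → simpleRoot j (simpleCoroot i) ≤ 0
  pairing_eq_zero : ∀ i j, simpleRoot j (simpleCoroot i) = 0 → simpleRoot i (simpleCoroot j) = 0

namespace KacMoodyRootDatum

variable {P : Type*} [AddCommGroup P] {I : Type*} (D : KacMoodyRootDatum P I)

/-- The simple reflection `sᵢ(μ) = μ - ⟨μ, αᵢ^∨⟩ αᵢ`. -/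
def simpleReflection (i : I) : P ≃ₗ[ℤ] P :=
  Module.reflection (D.pairing_self i)

/-- The Weyl group: the subgroup of `GL(P)` generated by the simple reflections. -/
def weylGroup : Subgroup (P ≃ₗ[ℤ] P) :=
  Subgroup.closure (Set.range D.simpleReflection)

/-- The contragredient action on weights, characterized by `⟨w μ, w f⟩ = ⟨μ, f⟩`. -/
def weightAct (w : P ≃ₗ[ℤ] P) (f : Module.Dual ℤ P) : Module.Dual ℤ P :=
  f ∘ₗ (w⁻¹ : P ≃ₗ[ℤ] P).toLinearMap

/-- A real root `β^∨ = w(αᵢ^∨)` together with its associated coroot `β = w(αᵢ)`. -/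
structure RealRoot where
  /-- the real root `β^∨ ∈ P^∨` -/
  root : Module.Dual ℤ P
  /-- the associated coroot `β ∈ P` -/
  coroot : P
  exists_eq : ∃ w ∈ D.weylGroup, ∃ i : I,
    root = weightAct w (D.simpleRoot i) ∧ coroot = w (D.simpleCoroot i)

/-- The cone of non-negative integral combinations of simple roots. -/
def rootCone : AddSubmonoid (Module.Dual ℤ P) :=
  AddSubmonoid.closure (Set.range D.simpleRoot)

/-- The set of real roots `{w(αᵢ^∨)}`. -/
def realRoots : Set (Module.Dual ℤ P) :=
  {γ | ∃ w ∈ D.weylGroup, ∃ i : I, γ = weightAct w (D.simpleRoot i)}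

/-- The set of positive real roots. -/
def posRealRoots : Set (Module.Dual ℤ P) :=
  {γ | γ ∈ D.realRoots ∧ γ ∈ D.rootCone}

/-- The set of negative real roots. -/
def negRealRoots : Set (Module.Dual ℤ P) :=
  {γ | γ ∈ D.realRoots ∧ -γ ∈ D.rootCone}

/-- The inversion set of `w`: the positive roots that `w` makes negative. Only real roots are
listed, since the Weyl group permutes the positive imaginary roots. -/
def inversionSet (w : P ≃ₗ[ℤ] P) : Set (Module.Dual ℤ P) :=
  {γ | γ ∈ D.posRealRoots ∧ weightAct w γ ∈ D.negRealRoots}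

theorem RealRoot.pairing_self {D : KacMoodyRootDatum P I} (b : D.RealRoot) :
    b.root b.coroot = 2 := by
  obtain ⟨w, -, i, h1, h2⟩ := b.exists_eq
  rw [h1, h2]
  simpa [weightAct] using D.pairing_self i

/-- The reflection `s_β(μ) = μ - ⟨μ, β^∨⟩ β` attached to a real root. -/
def RealRoot.reflection {D : KacMoodyRootDatum P I} (b : D.RealRoot) : P ≃ₗ[ℤ] P :=
  Module.reflection b.pairing_self

theorem RealRoot.reflection_mem {D : KacMoodyRootDatum P I} (b : D.RealRoot) :
    b.reflection ∈ D.weylGroup := by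
  obtain ⟨w, hw, i, h1, h2⟩ := b.exists_eq
  have h : b.reflection = w * D.simpleReflection i * w⁻¹ := by
    ext μ
    simp [RealRoot.reflection, simpleReflection, Module.reflection_apply, h1, h2, weightAct]
  rw [h]
  exact mul_mem (mul_mem hw (Subgroup.subset_closure ⟨i, rfl⟩)) (inv_mem hw)

/-- The action of the Weyl group on (the multiplicative copy of) the coweight lattice. -/
def weylAction : D.weylGroup →* MulAut (Multiplicative P) where
  toFun w := AddEquiv.toMultiplicative (w : P ≃ₗ[ℤ] P).toAddEquiv
  map_one' := rfl
  map_mul' _ _ := rfl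

/-- The group `W ⋉ P`. The element `π^μ w` has `left` component `μ` and `right` component `w`;
thus `(π^μ w) (π^ν v) = π^(μ + w(ν)) (w v)`. -/
abbrev WP : Type _ := Multiplicative P ⋊[D.weylAction] D.weylGroup

/-- The translation part `μ` of `π^μ w`. -/
def translation (x : D.WP) : P := Multiplicative.toAdd x.left

/-- The Weyl group part `w` of `π^μ w`. -/
def weylPart (x : D.WP) : P ≃ₗ[ℤ] P := (x.right : P ≃ₗ[ℤ] P)

/-- The dominant cone. -/
def dominantCone : Set P := {μ | ∀ i, 0 ≤ D.simpleRoot i μ}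

/-- The Tits cone: the union of the Weyl translates of the dominant cone. -/
def titsCone : Set P := {μ | ∃ w ∈ D.weylGroup, ∃ ν ∈ D.dominantCone, μ = w ν}

/-- The semigroup `W ⋉ T` inside `W ⋉ P`, as a type; products are taken in `W ⋉ P`. -/
def WT : Type _ := {x : D.WP // D.translation x ∈ D.titsCone}

/-- The action of `W ⋉ P` on elements `γ + n π` (encoded as `(γ, n)`):
`π^μ w (γ + n π) = w(γ) + (n + ⟨μ, w(γ)⟩) π`. -/
def affineAct (x : D.WP) (c : Module.Dual ℤ P × ℤ) : Module.Dual ℤ P × ℤ :=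
  (weightAct (D.weylPart x) c.1, c.2 + weightAct (D.weylPart x) c.1 (D.translation x))

/-- `β^∨ + n π` is a positive (real) double affine root. -/
def IsPosDoubleAffineRoot (c : Module.Dual ℤ P × ℤ) : Prop :=
  (c.1 ∈ D.posRealRoots ∧ 0 ≤ c.2) ∨ (c.1 ∈ D.negRealRoots ∧ 0 < c.2)

/-- The reflection `π^(n β) s_β` attached to `β^∨ + n π`, where `β` is the coroot of `β^∨`
(so `β` is a negative coroot when `β^∨` is negative). -/
def doubleAffineReflection (b : D.RealRoot) (n : ℤ) : D.WP :=
  ⟨Multiplicative.ofAdd (n • b.coroot), ⟨b.reflection, b.reflection_mem⟩⟩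

theorem exists_dominant {μ : P} (h : μ ∈ D.titsCone) :
    ∃ w ∈ D.weylGroup, w μ ∈ D.dominantCone := by
  obtain ⟨w, hw, ν, hν, rfl⟩ := h
  refine ⟨w⁻¹, inv_mem hw, ?_⟩
  have : w⁻¹ (w ν) = ν := w.symm_apply_apply ν
  rwa [this]

/-- A chosen `w(μ)` with `w ∈ W` and `w(μ)` dominant, for `μ` in the Tits cone. -/
noncomputable def dominantRep {μ : P} (h : μ ∈ D.titsCone) : P :=
  (D.exists_dominant h).choose μ

/-- `ρ^∨`, the sum of the chosen fundamental weights. -/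
def rho [Fintype I] (Λ : I → Module.Dual ℤ P) : Module.Dual ℤ P := ∑ i, Λ i

/-- The big length `ℓ(π^μ) = 2 ⟨w(μ), ρ^∨⟩`, where `w(μ)` is dominant. -/
noncomputable def bigLength (ρ : Module.Dual ℤ P) (x : D.WT) : ℤ :=
  2 * ρ (D.dominantRep x.2)

/-- The small length of `π^μ w`: the number of `β^∨ ∈ Inv(w⁻¹)` with `⟨μ, β^∨⟩ ≥ 0` minus the
number of those with `⟨μ, β^∨⟩ < 0`. -/
noncomputable def smallLength (x : D.WT) : ℤ :=
  ({γ | γ ∈ D.inversionSet (D.weylPart x.1)⁻¹ ∧ 0 ≤ γ (D.translation x.1)}.ncard : ℤ)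
    - ({γ | γ ∈ D.inversionSet (D.weylPart x.1)⁻¹ ∧ γ (D.translation x.1) < 0}.ncard : ℤ)

/-- The length, with values in `ℤ ⊕ ℤ ε` ordered lexicographically; `(a, b)` is `a + b ε`. -/
noncomputable def length (ρ : Module.Dual ℤ P) (x : D.WT) : ℤ ×ₗ ℤ :=
  toLex (D.bigLength ρ x, D.smallLength x)

/-- A generating inequality `y ≤ x` of the first Bruhat preorder: `x = y s_b` for a positive double
affine root `b` such that `y(b)` is positive. -/
def FirstStep (y x : D.WT) : Prop :=
  ∃ (b : D.RealRoot) (n : ℤ), D.IsPosDoubleAffineRoot (b.root, n) ∧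
    x.1 = y.1 * D.doubleAffineReflection b n ∧
    D.IsPosDoubleAffineRoot (D.affineAct y.1 (b.root, n))

/-- A generating inequality `y ≼ x` of the second Bruhat order: `x = y s_b` for a positive double
affine root `b`, and `ℓ(x) > ℓ(y)`. -/
def SecondStep (ρ : Module.Dual ℤ P) (y x : D.WT) : Prop :=
  ∃ (b : D.RealRoot) (n : ℤ), D.IsPosDoubleAffineRoot (b.root, n) ∧
    x.1 = y.1 * D.doubleAffineReflection b n ∧
    D.length ρ y < D.length ρ x

/-- The first (Braverman-Kazhdan-Patnaik) Bruhat preorder: the preorder generated by the first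
kind of steps. -/
def FirstBruhatLE : D.WT → D.WT → Prop := Relation.ReflTransGen D.FirstStep

/-- The second Bruhat order: the preorder generated by the second kind of steps. -/
def SecondBruhatLE (ρ : Module.Dual ℤ P) : D.WT → D.WT → Prop :=
  Relation.ReflTransGen (D.SecondStep ρ)

end KacMoodyRootDatum

/-!
The generating relations of the two preorders already coincide: for a positive double affine root
`b = β^∨ + nπ`, the root `y(b)` is positive exactly if `y s_b` is longer than `y`
(`isPosDoubleAffineRoot_affineAct_iff`). The length then increases strictly along the steps, which
gives antisymmetry.

Write `y = π^μ w`, `γ = w(β)` and `k = ⟨μ, γ^∨⟩`. Then `y(b) = γ^∨ + (n + k)π` and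
`y s_b = π^(μ + nγ) s_γ w`, where `n ≥ 0`.

* If `n` and `n + k` are nonzero, then `n(n + k)` is positive or negative according to whether `μ`
  lies strictly inside the segment from `μ + nγ` to its reflection, or the other way round. As
  `⟨λ, ρ^∨⟩` is strictly maximal at the dominant element of an orbit, the big length is strictly
  convex along the line `μ + ℤγ`, and so it alone decides (`height_dominantRep_lt`).

* If `n = 0` or `n + k = 0`, then `μ + nγ` is `μ` or `s_γ(μ)`, and the small length decides. Let
  `ℓ(w) = |Inv(w)|`, and let `v` be the element of the Weyl group such that `v⁻¹` makes negative
  exactly those positive real roots on which `μ` is negative (`exists_isMinimalFor`). Then the small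
  length of `π^μ w` is `ℓ(v⁻¹ w) - ℓ(v)` (`signedLength_eq`), and the claim reduces to the fact that
  `ℓ(w s_β) > ℓ(w)` if `β^∨` and `w(β^∨)` are positive (`numInv_lt_mul_reflection`), together with
  the additivity of `ℓ` over the stabilizer of a dominant coweight
  (`numInv_mul_of_isMinimalFor`).

Both parts rest on the fact that a real root is positive or negative, and its coroot likewise. This
is proved by induction on the word length, reducing to the dihedral subgroups generated by two simple
reflections (`mem_cones_of_wordLength_le`).
-/

namespace KacMoodyRootDatum

variable {P : Type*} [AddCommGroup P] {I : Type*} (D : KacMoodyRootDatum P I)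

/-! ### The action on weights -/

theorem weightAct_apply (w : P ≃ₗ[ℤ] P) (f : Module.Dual ℤ P) (μ : P) :
    weightAct w f μ = f (w⁻¹ μ) := rfl

@[simp] theorem weightAct_apply_apply (w : P ≃ₗ[ℤ] P) (f : Module.Dual ℤ P) (μ : P) :
    weightAct w f (w μ) = f μ :=
  congrArg f (w.symm_apply_apply μ)

@[simp] theorem weightAct_one (f : Module.Dual ℤ P) : weightAct 1 f = f := rfl

theorem weightAct_mul (v w : P ≃ₗ[ℤ] P) (f : Module.Dual ℤ P) :
    weightAct (v * w) f = weightAct v (weightAct w f) := by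
  ext μ
  simp [weightAct_apply, mul_inv_rev]

@[simp] theorem weightAct_inv_self (w : P ≃ₗ[ℤ] P) (f : Module.Dual ℤ P) :
    weightAct w⁻¹ (weightAct w f) = f := by
  rw [← weightAct_mul, inv_mul_cancel, weightAct_one]

@[simp] theorem weightAct_self_inv (w : P ≃ₗ[ℤ] P) (f : Module.Dual ℤ P) :
    weightAct w (weightAct w⁻¹ f) = f := by
  rw [← weightAct_mul, mul_inv_cancel, weightAct_one]

@[simp] theorem weightAct_neg (w : P ≃ₗ[ℤ] P) (f : Module.Dual ℤ P) :
    weightAct w (-f) = -weightAct w f := rfl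

@[simp] theorem weightAct_add (w : P ≃ₗ[ℤ] P) (f g : Module.Dual ℤ P) :
    weightAct w (f + g) = weightAct w f + weightAct w g := rfl

@[simp] theorem weightAct_sub (w : P ≃ₗ[ℤ] P) (f g : Module.Dual ℤ P) :
    weightAct w (f - g) = weightAct w f - weightAct w g := rfl

@[simp] theorem weightAct_smul (w : P ≃ₗ[ℤ] P) (n : ℤ) (f : Module.Dual ℤ P) :
    weightAct w (n • f) = n • weightAct w f := rfl

theorem weightAct_injective (w : P ≃ₗ[ℤ] P) : Function.Injective (weightAct w) :=
  Function.LeftInverse.injective (weightAct_inv_self w)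

theorem simpleReflection_apply (i : I) (μ : P) :
    D.simpleReflection i μ = μ - D.simpleRoot i μ • D.simpleCoroot i :=
  Module.reflection_apply _ _

@[simp] theorem simpleReflection_mul_self (i : I) :
    D.simpleReflection i * D.simpleReflection i = 1 := by
  ext μ
  exact Module.involutive_reflection (D.pairing_self i) μ

@[simp] theorem simpleReflection_inv (i : I) :
    (D.simpleReflection i)⁻¹ = D.simpleReflection i :=
  inv_eq_of_mul_eq_one_left (D.simpleReflection_mul_self i)

theorem simpleReflection_mem (i : I) : D.simpleReflection i ∈ D.weylGroup :=
  Subgroup.subset_closure ⟨i, rfl⟩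

theorem simpleReflection_simpleCoroot (i : I) :
    D.simpleReflection i (D.simpleCoroot i) = -D.simpleCoroot i := by
  rw [simpleReflection_apply, D.pairing_self]
  module

theorem weightAct_simpleReflection (i : I) (f : Module.Dual ℤ P) :
    weightAct (D.simpleReflection i) f = f - f (D.simpleCoroot i) • D.simpleRoot i := by
  ext μ
  rw [weightAct_apply, simpleReflection_inv, simpleReflection_apply]
  simp [mul_comm]

theorem weightAct_simpleReflection_simpleRoot (i : I) :
    weightAct (D.simpleReflection i) (D.simpleRoot i) = -D.simpleRoot i := by
  rw [weightAct_simpleReflection, D.pairing_self]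
  module

/-! ### Word length in the Weyl group -/

/-- The least number of simple reflections with product `w`. It has the junk value `0` outside the
Weyl group. -/
noncomputable def wordLength (w : P ≃ₗ[ℤ] P) : ℕ :=
  sInf {n | ∃ l : List I, l.length = n ∧ (l.map D.simpleReflection).prod = w}

theorem exists_word {w : P ≃ₗ[ℤ] P} (hw : w ∈ D.weylGroup) :
    ∃ l : List I, (l.map D.simpleReflection).prod = w := by
  induction hw using Subgroup.closure_induction_right with
  | one => exact ⟨[], rfl⟩
  | mul_right x _ y hy ih =>
    obtain ⟨i, rfl⟩ := hy
    obtain ⟨l, rfl⟩ := ih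
    exact ⟨l ++ [i], by simp⟩
  | mul_inv_cancel x _ y hy ih =>
    obtain ⟨i, rfl⟩ := hy
    obtain ⟨l, rfl⟩ := ih
    exact ⟨l ++ [i], by simp⟩

theorem exists_reduced_word {w : P ≃ₗ[ℤ] P} (hw : w ∈ D.weylGroup) :
    ∃ l : List I, l.length = D.wordLength w ∧ (l.map D.simpleReflection).prod = w := by
  obtain ⟨l, hl⟩ := D.exists_word hw
  exact Nat.sInf_mem
    (s := {n | ∃ l : List I, l.length = n ∧ (l.map D.simpleReflection).prod = w}) ⟨_, l, rfl, hl⟩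

theorem wordLength_prod_le (l : List I) :
    D.wordLength (l.map D.simpleReflection).prod ≤ l.length :=
  Nat.sInf_le ⟨l, rfl, rfl⟩

theorem wordLength_mul_simpleReflection_le {w : P ≃ₗ[ℤ] P} (hw : w ∈ D.weylGroup) (i : I) :
    D.wordLength (w * D.simpleReflection i) ≤ D.wordLength w + 1 := by
  obtain ⟨l, hl, rfl⟩ := D.exists_reduced_word hw
  have h := D.wordLength_prod_le (l ++ [i])
  simp only [List.map_append, List.map_cons, List.map_nil, List.prod_append, List.prod_cons,
    List.prod_nil, mul_one, List.length_append, List.length_cons, List.length_nil] at h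
  omega

/-- A nontrivial element of the Weyl group has a right descent. -/
theorem exists_wordLength_mul_lt {w : P ≃ₗ[ℤ] P} (hw : w ∈ D.weylGroup) (h1 : w ≠ 1) :
    ∃ i, D.wordLength (w * D.simpleReflection i) < D.wordLength w := by
  obtain ⟨l, hl, rfl⟩ := D.exists_reduced_word hw
  rcases List.eq_nil_or_concat l with rfl | ⟨l', i, rfl⟩
  · exact absurd rfl h1
  · refine ⟨i, ?_⟩
    have h := D.wordLength_prod_le l'
    have e : (((l'.concat i).map D.simpleReflection).prod) * D.simpleReflection i
        = (l'.map D.simpleReflection).prod := by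
      simp [mul_assoc]
    rw [e, ← hl]
    simp only [List.length_concat]
    omega

/-! ### Dihedral subgroups -/

/-- The alternating product `⋯ sᵢ sⱼ sᵢ sⱼ` of `n` simple reflections, ending in `sⱼ`. -/
def altProd : I → I → ℕ → (P ≃ₗ[ℤ] P)
  | _, _, 0 => 1
  | i, j, n + 1 => altProd j i n * D.simpleReflection j

@[simp] theorem altProd_zero (i j : I) : D.altProd i j 0 = 1 := rfl

theorem altProd_succ (i j : I) (n : ℕ) :
    D.altProd i j (n + 1) = D.altProd j i n * D.simpleReflection j := rfl

theorem altProd_succ_left (i j : I) (n : ℕ) :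
    D.altProd i j (n + 1)
      = D.simpleReflection (if Even n then j else i) * D.altProd i j n := by
  induction n generalizing i j with
  | zero => simp [altProd]
  | succ n ih =>
    rw [altProd_succ, ih, altProd_succ, mul_assoc]
    by_cases h : Even n <;> simp [h, Nat.even_add_one]

theorem altProd_mem (i j : I) (n : ℕ) : D.altProd i j n ∈ D.weylGroup := by
  induction n generalizing i j with
  | zero => exact one_mem _
  | succ n ih => exact mul_mem (ih j i) (D.simpleReflection_mem j)

theorem wordLength_mul_altProd_le {w : P ≃ₗ[ℤ] P} (hw : w ∈ D.weylGroup) (i j : I) (n : ℕ) :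
    D.wordLength (w * D.altProd i j n) ≤ D.wordLength w + n := by
  induction n generalizing i j with
  | zero => simp
  | succ n ih =>
    rw [altProd_succ, ← mul_assoc]
    have h1 := D.wordLength_mul_simpleReflection_le (mul_mem hw (D.altProd_mem j i n)) j
    have h2 := ih j i
    omega

/-- If `v` is followed by an alternating product of length at least `m`, the last `m` factors of
which can be rewritten to end in `sᵢ`, then `sᵢ` shortens the product. -/
theorem wordLength_mul_altProd_mul_lt {v : P ≃ₗ[ℤ] P} (hv : v ∈ D.weylGroup) (i j : I) (m k : ℕ)
    (hm : D.altProd i j (m + 1) = D.altProd j i (m + 1)) :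
    D.wordLength (v * D.altProd i j (k + (m + 1)) * D.simpleReflection i)
      < D.wordLength v + (k + (m + 1)) := by
  induction k generalizing v with
  | zero =>
    rw [zero_add, hm, altProd_succ, mul_assoc, mul_assoc, simpleReflection_mul_self, mul_one]
    have := D.wordLength_mul_altProd_le hv i j m
    omega
  | succ k ih =>
    rw [add_right_comm, altProd_succ_left, ← mul_assoc v]
    refine (ih (mul_mem hv (D.simpleReflection_mem _))).trans_le ?_
    have := D.wordLength_mul_simpleReflection_le hv (if Even (k + (m + 1)) then j else i)
    omega

/-- The coefficients `(p, q)` in `(altProd i j n) αᵢ = p αᵢ + q αⱼ`, where `a = -⟨αᵢ, αⱼ^∨⟩` and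
`b = -⟨αⱼ, αᵢ^∨⟩`. -/
def altCoeff : ℤ → ℤ → ℕ → ℤ × ℤ
  | _, _, 0 => (1, 0)
  | a, _, 1 => (1, a)
  | a, b, n + 2 => a • (altCoeff b a (n + 1)).swap - altCoeff a b n

theorem altProd_simpleCoroot (i j : I) (n : ℕ) :
    D.altProd i j n (D.simpleCoroot i)
      = (altCoeff (-D.simpleRoot j (D.simpleCoroot i)) (-D.simpleRoot i (D.simpleCoroot j)) n).1
          • D.simpleCoroot i
        + (altCoeff (-D.simpleRoot j (D.simpleCoroot i)) (-D.simpleRoot i (D.simpleCoroot j)) n).2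
          • D.simpleCoroot j := by
  induction n using Nat.strong_induction_on generalizing i j with
  | _ n ih =>
    match n with
    | 0 => simp [altCoeff]
    | 1 =>
      simp only [altProd, altCoeff, one_mul, simpleReflection_apply]
      module
    | n + 2 =>
      have h1 : D.altProd i j (n + 2) (D.simpleCoroot i)
          = -D.altProd i j n (D.simpleCoroot i)
            - D.simpleRoot j (D.simpleCoroot i) • D.altProd j i (n + 1) (D.simpleCoroot j) := by
        rw [altProd_succ, LinearEquiv.mul_apply, simpleReflection_apply, map_sub, map_smul]
        congr 1
        rw [altProd_succ, LinearEquiv.mul_apply, simpleReflection_simpleCoroot, map_neg]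
      rw [h1, ih n (by omega), ih (n + 1) (by omega)]
      simp only [altCoeff, Prod.fst_sub, Prod.snd_sub, Prod.smul_fst, Prod.smul_snd, Prod.fst_swap,
        Prod.snd_swap, smul_eq_mul]
      module

theorem weightAct_altProd_simpleRoot (i j : I) (n : ℕ) :
    weightAct (D.altProd i j n) (D.simpleRoot i)
      = (altCoeff (-D.simpleRoot i (D.simpleCoroot j)) (-D.simpleRoot j (D.simpleCoroot i)) n).1
          • D.simpleRoot i
        + (altCoeff (-D.simpleRoot i (D.simpleCoroot j)) (-D.simpleRoot j (D.simpleCoroot i)) n).2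
          • D.simpleRoot j := by
  induction n using Nat.strong_induction_on generalizing i j with
  | _ n ih =>
    match n with
    | 0 => simp [altCoeff]
    | 1 =>
      simp only [altProd, altCoeff, one_mul, weightAct_simpleReflection]
      module
    | n + 2 =>
      have h1 : weightAct (D.altProd i j (n + 2)) (D.simpleRoot i)
          = -weightAct (D.altProd i j n) (D.simpleRoot i)
            - D.simpleRoot i (D.simpleCoroot j)
              • weightAct (D.altProd j i (n + 1)) (D.simpleRoot j) := by
        rw [altProd_succ, weightAct_mul, weightAct_simpleReflection, weightAct_sub, weightAct_smul]
        congr 1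
        rw [altProd_succ, weightAct_mul, weightAct_simpleReflection_simpleRoot, weightAct_neg]
      rw [h1, ih n (by omega), ih (n + 1) (by omega)]
      simp only [altCoeff, Prod.fst_sub, Prod.snd_sub, Prod.smul_fst, Prod.smul_snd, Prod.fst_swap,
        Prod.snd_swap, smul_eq_mul]
      module

/-- The coefficients grow along weighted steps: the weights `p, q` with `2q ≤ pa` and `2p ≤ qb`
exist exactly when `ab ≥ 4`, the case of an infinite dihedral group. -/
theorem altCoeff_nonneg_of_weights {a b p q : ℤ} (hp : 0 < p) (hq : 0 < q)
    (hpa : 2 * q ≤ p * a) (hqb : 2 * p ≤ q * b) (n : ℕ) :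
    0 ≤ altCoeff a b n ∧ 0 ≤ altCoeff b a n ∧
      q • (altCoeff b a n).swap ≤ p • altCoeff a b (n + 1) ∧
      p • (altCoeff a b n).swap ≤ q • altCoeff b a (n + 1) := by
  induction n with
  | zero =>
    simp only [altCoeff, Prod.le_def, Prod.fst_zero, Prod.snd_zero, Prod.smul_fst, Prod.smul_snd,
      Prod.fst_swap, Prod.snd_swap, smul_eq_mul]
    refine ⟨⟨?_, ?_⟩, ⟨?_, ?_⟩, ⟨?_, ?_⟩, ?_, ?_⟩ <;> linarith
  | succ n ih =>
    have key : ∀ {a p q : ℤ}, 0 < p → 2 * q ≤ p * a → ∀ {x₀ x₁ x₂ y₀ y₁ : ℤ},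
        0 ≤ y₀ → 0 ≤ x₀ → 0 < q → q * y₀ ≤ p * x₁ → p * x₀ ≤ q * y₁ → x₂ = a * y₁ - x₀ →
        0 ≤ x₁ ∧ q * y₁ ≤ p * x₂ := by
      rintro a p q hp hpa x₀ x₁ x₂ y₀ y₁ hy₀ hx₀ hq h1 h2 rfl
      have hy₁ : 0 ≤ y₁ := by nlinarith [mul_nonneg hp.le hx₀]
      refine ⟨by nlinarith [mul_nonneg hq.le hy₀], ?_⟩
      nlinarith [mul_le_mul_of_nonneg_right hpa hy₁]
    simp only [Prod.le_def, Prod.fst_zero, Prod.snd_zero, Prod.smul_fst, Prod.smul_snd,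
      Prod.fst_swap, Prod.snd_swap, smul_eq_mul] at ih
    obtain ⟨⟨h1, h2⟩, ⟨h3, h4⟩, ⟨h5, h6⟩, h7, h8⟩ := ih
    have k1 := key hp hpa h4 h1 hq h5 h8 (x₂ := (altCoeff a b (n + 2)).1) rfl
    have k2 := key hp hpa h3 h2 hq h6 h7 (x₂ := (altCoeff a b (n + 2)).2) rfl
    have k3 := key hq hqb h2 h3 hp h7 h6 (x₂ := (altCoeff b a (n + 2)).1) rfl
    have k4 := key hq hqb h1 h4 hp h8 h5 (x₂ := (altCoeff b a (n + 2)).2) rfl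
    exact ⟨⟨k1.1, k2.1⟩, ⟨k3.1, k4.1⟩, ⟨k1.2, k2.2⟩, k3.2, k4.2⟩

theorem altCoeff_nonneg_of_four_le {a b : ℤ} (ha : 0 ≤ a) (hb : 0 ≤ b) (hab : 4 ≤ a * b) (n : ℕ) :
    0 ≤ altCoeff a b n := by
  have ha1 : 1 ≤ a := by
    by_contra h
    obtain rfl : a = 0 := by omega
    omega
  have hb1 : 1 ≤ b := by
    by_contra h
    obtain rfl : b = 0 := by omega
    omega
  rcases eq_or_lt_of_le ha1 with rfl | ha2
  · exact (altCoeff_nonneg_of_weights (p := 2) (q := 1) (by omega) (by omega) (by omega)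
      (by omega) n).1
  rcases eq_or_lt_of_le hb1 with rfl | hb2
  · exact (altCoeff_nonneg_of_weights (p := 1) (q := 2) (by omega) (by omega) (by omega)
      (by omega) n).1
  · exact (altCoeff_nonneg_of_weights (p := 1) (q := 1) (by omega) (by omega) (by omega)
      (by omega) n).1

theorem simpleReflection_sub_sub (i j : I) (μ : P) (p q : ℤ) :
    D.simpleReflection i (μ - p • D.simpleCoroot i - q • D.simpleCoroot j)
      = μ - (D.simpleRoot i μ - p - q * D.simpleRoot i (D.simpleCoroot j)) • D.simpleCoroot i
        - q • D.simpleCoroot j := by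
  rw [simpleReflection_apply]
  simp only [map_sub, map_smul, D.pairing_self, smul_eq_mul]
  module

theorem simpleReflection_sub_sub' (i j : I) (μ : P) (p q : ℤ) :
    D.simpleReflection j (μ - p • D.simpleCoroot i - q • D.simpleCoroot j)
      = μ - p • D.simpleCoroot i
        - (D.simpleRoot j μ - q - p * D.simpleRoot j (D.simpleCoroot i)) • D.simpleCoroot j := by
  rw [simpleReflection_apply]
  simp only [map_sub, map_smul, D.pairing_self, smul_eq_mul]
  module

/-- The coefficients of an alternating product of length `n` are non-negative, unless a braid
relation of length at most `n` holds between `sᵢ` and `sⱼ`. -/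
theorem altProd_rankTwo {i j : I} (hij : i ≠ j) (n : ℕ) :
    (0 ≤ altCoeff (-D.simpleRoot j (D.simpleCoroot i)) (-D.simpleRoot i (D.simpleCoroot j)) n ∧
      0 ≤ altCoeff (-D.simpleRoot i (D.simpleCoroot j)) (-D.simpleRoot j (D.simpleCoroot i)) n) ∨
    ∃ m < n, D.altProd i j (m + 1) = D.altProd j i (m + 1) := by
  obtain ⟨a, ha⟩ : ∃ a, D.simpleRoot j (D.simpleCoroot i) = -a := ⟨_, (neg_neg _).symm⟩
  obtain ⟨b, hb⟩ : ∃ b, D.simpleRoot i (D.simpleCoroot j) = -b := ⟨_, (neg_neg _).symm⟩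
  have ha0 := D.pairing_nonpos i j hij
  have hb0 := D.pairing_nonpos j i hij.symm
  have hz1 := D.pairing_eq_zero i j
  have hz2 := D.pairing_eq_zero j i
  rw [ha] at ha0 hz1 hz2
  rw [hb] at hb0 hz1 hz2
  rw [ha, hb]
  simp only [neg_neg]
  have ha0' : 0 ≤ a := by omega
  have hb0' : 0 ≤ b := by omega
  rcases le_or_gt 4 (a * b) with hab | hab
  · left
    exact ⟨altCoeff_nonneg_of_four_le ha0' hb0' hab n,
      altCoeff_nonneg_of_four_le hb0' ha0' (by rwa [mul_comm]) n⟩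
  -- In the finite cases, non-negativity up to length `m` and a braid relation of length `m + 1`
  -- suffice.
  have fin : ∀ m : ℕ, (∀ k ≤ m, 0 ≤ altCoeff a b k ∧ 0 ≤ altCoeff b a k) →
      D.altProd i j (m + 1) = D.altProd j i (m + 1) →
      (0 ≤ altCoeff a b n ∧ 0 ≤ altCoeff b a n) ∨
        ∃ m < n, D.altProd i j (m + 1) = D.altProd j i (m + 1) := by
    intro m h1 h2
    rcases le_or_gt n m with h | h
    · exact Or.inl (h1 n h)
    · exact Or.inr ⟨m, h, h2⟩
  have start : ∀ μ : P, μ = μ - (0 : ℤ) • D.simpleCoroot i - (0 : ℤ) • D.simpleCoroot j := by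
    intro μ; module
  have cases : (a = 0 ∧ b = 0) ∨ (a = 1 ∧ b = 1) ∨ (a = 1 ∧ b = 2) ∨ (a = 2 ∧ b = 1) ∨
      (a = 1 ∧ b = 3) ∨ (a = 3 ∧ b = 1) := by
    rcases eq_or_lt_of_le ha0' with h | h
    · subst h
      left
      have := hz1 rfl
      omega
    · have hb1 : 0 < b := by
        rcases eq_or_lt_of_le hb0' with h' | h'
        · subst h'
          have := hz2 rfl
          omega
        · exact h'
      have h3 : a ≤ 3 := by nlinarith
      have h4 : b ≤ 3 := by nlinarith
      interval_cases a <;> interval_cases b <;> omega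
  rcases cases with ⟨rfl, rfl⟩ | ⟨rfl, rfl⟩ | ⟨rfl, rfl⟩ | ⟨rfl, rfl⟩ | ⟨rfl, rfl⟩ | ⟨rfl, rfl⟩ <;>
    [refine fin 1 ?_ ?_; refine fin 2 ?_ ?_; refine fin 3 ?_ ?_; refine fin 3 ?_ ?_;
      refine fin 5 ?_ ?_; refine fin 5 ?_ ?_]
  all_goals first
    | intro k hk
      interval_cases k <;> simp [altCoeff, Prod.le_def]
    | ext μ
      simp only [altProd, one_mul, LinearEquiv.mul_apply]
      rw [start μ]
      simp only [simpleReflection_sub_sub, simpleReflection_sub_sub', ha, hb]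
      module

/-! ### Positivity of roots and coroots -/

/-- The cone of non-negative integral combinations of simple coroots. -/
def corootCone : AddSubmonoid P :=
  AddSubmonoid.closure (Set.range D.simpleCoroot)

theorem simpleRoot_mem_rootCone (i : I) : D.simpleRoot i ∈ D.rootCone :=
  AddSubmonoid.subset_closure ⟨i, rfl⟩

theorem simpleCoroot_mem_corootCone (i : I) : D.simpleCoroot i ∈ D.corootCone :=
  AddSubmonoid.subset_closure ⟨i, rfl⟩

theorem zsmul_mem_of_nonneg {M : Type*} [AddCommGroup M] (S : AddSubmonoid M) {x : M} (hx : x ∈ S)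
    {n : ℤ} (hn : 0 ≤ n) : n • x ∈ S := by
  lift n to ℕ using hn
  rw [natCast_zsmul]
  exact nsmul_mem hx n

/-- An element of the Weyl group that `sᵢ` does not shorten on the right maps `αᵢ` and `αᵢ^∨` to
positive combinations. The proof splits off the longest alternating right factor in `sᵢ` and `sⱼ`,
where `sⱼ` is a right descent, and applies the induction hypothesis to what remains. -/
theorem mem_cones_of_wordLength_le {w : P ≃ₗ[ℤ] P} (hw : w ∈ D.weylGroup) {i : I}
    (hi : D.wordLength w ≤ D.wordLength (w * D.simpleReflection i)) :
    w (D.simpleCoroot i) ∈ D.corootCone ∧ weightAct w (D.simpleRoot i) ∈ D.rootCone := by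
  classical
  induction hn : D.wordLength w using Nat.strong_induction_on generalizing w i with
  | _ N ih =>
    subst hn
    by_cases h1 : w = 1
    · subst h1
      exact ⟨D.simpleCoroot_mem_corootCone i, D.simpleRoot_mem_rootCone i⟩
    obtain ⟨j, hj⟩ := D.exists_wordLength_mul_lt hw h1
    have hij : i ≠ j := by
      rintro rfl
      omega
    let Q : ℕ → Prop := fun n => D.wordLength (w * (D.altProd i j n)⁻¹) + n ≤ D.wordLength w
    have hQ1 : Q 1 := by
      simp only [Q, altProd, one_mul, simpleReflection_inv]
      omega
    have hb : 1 ≤ D.wordLength w := by omega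
    set n := Nat.findGreatest Q (D.wordLength w) with hn
    have hQn : Q n := Nat.findGreatest_spec hb hQ1
    have hn1 : 1 ≤ n := Nat.le_findGreatest hb hQ1
    have hQn' : ¬ Q (n + 1) := by
      intro h
      have h' : n + 1 ≤ D.wordLength w := by
        simp only [Q] at h
        omega
      have := Nat.le_findGreatest h' h
      omega
    set v := w * (D.altProd i j n)⁻¹ with hvdef
    have hv : v ∈ D.weylGroup := mul_mem hw (inv_mem (D.altProd_mem i j n))
    have hwv : w = v * D.altProd i j n := by simp [hvdef]
    have hvn : D.wordLength v + n ≤ D.wordLength w := hQn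
    have hwn : ∀ u ∈ D.weylGroup, ∀ k, D.wordLength (u * D.altProd i j k) ≤ D.wordLength u + k :=
      fun u hu k => D.wordLength_mul_altProd_le hu i j k
    -- The remaining factor is shortened neither by the next letter of the alternating word ...
    have next : D.wordLength v
        ≤ D.wordLength (v * D.simpleReflection (if Even n then j else i)) := by
      by_contra h
      apply hQn'
      simp only [Q]
      rw [altProd_succ_left, mul_inv_rev, simpleReflection_inv, ← mul_assoc, ← hvdef]
      omega
    -- ... nor by its first letter.
    have first : D.wordLength v
        ≤ D.wordLength (v * D.simpleReflection (if Even n then i else j)) := by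
      by_contra h
      obtain ⟨m, hm⟩ : ∃ m, n = m + 1 := ⟨n - 1, by omega⟩
      rw [hm] at h hwv hvn
      have e : (if Even (m + 1) then i else j) = if Even m then j else i := by
        by_cases hm : Even m <;> simp [hm, Nat.even_add_one]
      have h2 := hwn _ (mul_mem hv (D.simpleReflection_mem (if Even m then j else i))) m
      rw [mul_assoc, ← altProd_succ_left, ← hwv] at h2
      rw [e] at h
      omega
    have both : D.wordLength v ≤ D.wordLength (v * D.simpleReflection i) ∧
        D.wordLength v ≤ D.wordLength (v * D.simpleReflection j) := by
      by_cases h : Even n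
      · simp only [h, if_true] at next first
        exact ⟨first, next⟩
      · simp only [h, if_false] at next first
        exact ⟨next, first⟩
    obtain ⟨hvi, hvi'⟩ := ih _ (by omega) hv both.1 rfl
    obtain ⟨hvj, hvj'⟩ := ih _ (by omega) hv both.2 rfl
    rcases D.altProd_rankTwo hij n with ⟨hpos, hpos'⟩ | ⟨m, hm, hbraid⟩
    · constructor
      · rw [hwv, LinearEquiv.mul_apply, altProd_simpleCoroot, map_add, map_smul, map_smul]
        exact add_mem (zsmul_mem_of_nonneg _ hvi hpos.1) (zsmul_mem_of_nonneg _ hvj hpos.2)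
      · rw [hwv, weightAct_mul, weightAct_altProd_simpleRoot, weightAct_add, weightAct_smul,
          weightAct_smul]
        exact add_mem (zsmul_mem_of_nonneg _ hvi' hpos'.1) (zsmul_mem_of_nonneg _ hvj' hpos'.2)
    · exfalso
      have h := D.wordLength_mul_altProd_mul_lt hv i j m (n - (m + 1)) hbraid
      rw [Nat.sub_add_cancel (by omega), ← hwv] at h
      omega

/-- Every real root is a non-negative or a non-positive combination of simple roots. -/
theorem mem_rootCone_or_neg_mem {γ : Module.Dual ℤ P} (hγ : γ ∈ D.realRoots) :
    γ ∈ D.rootCone ∨ -γ ∈ D.rootCone := by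
  obtain ⟨w, hw, i, rfl⟩ := hγ
  rcases le_or_gt (D.wordLength w) (D.wordLength (w * D.simpleReflection i)) with h | h
  · exact Or.inl (D.mem_cones_of_wordLength_le hw h).2
  · right
    have h' := (D.mem_cones_of_wordLength_le (i := i) (mul_mem hw (D.simpleReflection_mem i))
      (by rw [mul_assoc, simpleReflection_mul_self, mul_one]; exact h.le)).2
    rwa [weightAct_mul, weightAct_simpleReflection_simpleRoot, weightAct_neg] at h'

/-- A dominant coweight is the highest one in its orbit. -/
theorem sub_apply_mem_corootCone {μ : P} (hμ : μ ∈ D.dominantCone) {w : P ≃ₗ[ℤ] P}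
    (hw : w ∈ D.weylGroup) : μ - w μ ∈ D.corootCone := by
  induction hn : D.wordLength w using Nat.strong_induction_on generalizing w with
  | _ n ih =>
    subst hn
    by_cases h1 : w = 1
    · simp [h1]
    obtain ⟨i, hi⟩ := D.exists_wordLength_mul_lt hw h1
    have hv := mul_mem hw (D.simpleReflection_mem i)
    set v := w * D.simpleReflection i with hvdef
    have hwv : w = v * D.simpleReflection i := by
      rw [hvdef, mul_assoc, simpleReflection_mul_self, mul_one]
    have hvi := (D.mem_cones_of_wordLength_le hv (i := i) (by rw [← hwv]; exact hi.le)).1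
    have e : μ - w μ = (μ - v μ) + D.simpleRoot i μ • v (D.simpleCoroot i) := by
      rw [hwv, LinearEquiv.mul_apply, simpleReflection_apply, map_sub, map_smul]
      abel
    rw [e]
    exact add_mem (ih _ hi hv rfl) (zsmul_mem_of_nonneg _ hvi (hμ i))

/-! ### Positive and negative real roots -/

theorem weightAct_mem_realRoots {w : P ≃ₗ[ℤ] P} (hw : w ∈ D.weylGroup) {γ : Module.Dual ℤ P}
    (hγ : γ ∈ D.realRoots) : weightAct w γ ∈ D.realRoots := by
  obtain ⟨v, hv, i, rfl⟩ := hγ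
  exact ⟨w * v, mul_mem hw hv, i, (weightAct_mul _ _ _).symm⟩

theorem neg_mem_realRoots {γ : Module.Dual ℤ P} (hγ : γ ∈ D.realRoots) : -γ ∈ D.realRoots := by
  obtain ⟨v, hv, i, rfl⟩ := hγ
  refine ⟨v * D.simpleReflection i, mul_mem hv (D.simpleReflection_mem i), i, ?_⟩
  rw [weightAct_mul, weightAct_simpleReflection_simpleRoot, weightAct_neg]

theorem exists_realRoot {γ : Module.Dual ℤ P} (hγ : γ ∈ D.realRoots) :
    ∃ b : D.RealRoot, b.root = γ := by
  obtain ⟨v, hv, i, rfl⟩ := hγ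
  exact ⟨⟨_, _, v, hv, i, rfl, rfl⟩, rfl⟩

theorem ne_zero_of_mem_realRoots {γ : Module.Dual ℤ P} (hγ : γ ∈ D.realRoots) : γ ≠ 0 := by
  obtain ⟨b, rfl⟩ := D.exists_realRoot hγ
  intro h
  have := b.pairing_self
  simp [h] at this

theorem exists_coeff_of_mem_rootCone {f : Module.Dual ℤ P} (hf : f ∈ D.rootCone) :
    ∃ c : I →₀ ℤ, 0 ≤ c ∧ Finsupp.linearCombination ℤ D.simpleRoot c = f := by
  induction hf using AddSubmonoid.closure_induction with
  | mem x hx =>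
    obtain ⟨i, rfl⟩ := hx
    exact ⟨Finsupp.single i 1, Finsupp.single_nonneg.2 zero_le_one, by simp⟩
  | zero => exact ⟨0, le_rfl, map_zero _⟩
  | add x y _ _ hx hy =>
    obtain ⟨c, hc, rfl⟩ := hx
    obtain ⟨d, hd, rfl⟩ := hy
    exact ⟨c + d, add_nonneg hc hd, map_add _ _ _⟩

variable {D}

theorem neg_mem_rootCone_iff (hroot : LinearIndependent ℤ D.simpleRoot) {γ : Module.Dual ℤ P}
    (hγ : γ ∈ D.realRoots) : -γ ∈ D.rootCone ↔ γ ∉ D.rootCone := by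
  refine ⟨fun h h' => ?_, fun h => (D.mem_rootCone_or_neg_mem hγ).resolve_left h⟩
  obtain ⟨c, hc, hcγ⟩ := D.exists_coeff_of_mem_rootCone h
  obtain ⟨d, hd, hdγ⟩ := D.exists_coeff_of_mem_rootCone h'
  have h0 : c + d = 0 := hroot (by rw [map_add, hcγ, hdγ, map_zero, neg_add_cancel])
  have hd0 : d = 0 := le_antisymm (by rw [← h0]; exact le_add_of_nonneg_left hc) hd
  apply D.ne_zero_of_mem_realRoots hγ
  rw [← hdγ, hd0, map_zero]

theorem mem_posRealRoots_iff {γ : Module.Dual ℤ P} (hγ : γ ∈ D.realRoots) :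
    γ ∈ D.posRealRoots ↔ γ ∈ D.rootCone :=
  and_iff_right hγ

theorem mem_negRealRoots_iff (hroot : LinearIndependent ℤ D.simpleRoot) {γ : Module.Dual ℤ P}
    (hγ : γ ∈ D.realRoots) : γ ∈ D.negRealRoots ↔ γ ∉ D.rootCone :=
  (and_iff_right hγ).trans (neg_mem_rootCone_iff hroot hγ)

theorem mem_inversionSet_iff (hroot : LinearIndependent ℤ D.simpleRoot) {w : P ≃ₗ[ℤ] P}
    (hw : w ∈ D.weylGroup) {γ : Module.Dual ℤ P} :
    γ ∈ D.inversionSet w ↔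
      γ ∈ D.realRoots ∧ γ ∈ D.rootCone ∧ weightAct w γ ∉ D.rootCone := by
  constructor
  · rintro ⟨⟨h1, h2⟩, h3⟩
    exact ⟨h1, h2, (mem_negRealRoots_iff hroot (D.weightAct_mem_realRoots hw h1)).1 h3⟩
  · rintro ⟨h1, h2, h3⟩
    exact ⟨⟨h1, h2⟩, (mem_negRealRoots_iff hroot (D.weightAct_mem_realRoots hw h1)).2 h3⟩

/-! ### Reflections in real roots -/

namespace RealRoot

variable (b : D.RealRoot)

theorem root_mem : b.root ∈ D.realRoots := by
  obtain ⟨w, hw, i, h, -⟩ := b.exists_eq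
  exact ⟨w, hw, i, h⟩

theorem reflection_apply (μ : P) : b.reflection μ = μ - b.root μ • b.coroot :=
  Module.reflection_apply _ _

@[simp] theorem reflection_mul_self : b.reflection * b.reflection = 1 := by
  ext μ
  exact Module.involutive_reflection b.pairing_self μ

@[simp] theorem reflection_inv : b.reflection⁻¹ = b.reflection :=
  inv_eq_of_mul_eq_one_left b.reflection_mul_self

theorem weightAct_reflection (f : Module.Dual ℤ P) :
    weightAct b.reflection f = f - f b.coroot • b.root := by
  ext μ
  rw [weightAct_apply, reflection_inv, reflection_apply]
  simp [mul_comm]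

theorem weightAct_reflection_root : weightAct b.reflection b.root = -b.root := by
  rw [weightAct_reflection, b.pairing_self]
  module

/-- The real root `w(β^∨)`, with coroot `w(β)`. -/
def act (w : P ≃ₗ[ℤ] P) (hw : w ∈ D.weylGroup) : D.RealRoot where
  root := weightAct w b.root
  coroot := w b.coroot
  exists_eq := by
    obtain ⟨v, hv, i, h1, h2⟩ := b.exists_eq
    exact ⟨w * v, mul_mem hw hv, i, by rw [h1, weightAct_mul], by rw [h2, LinearEquiv.mul_apply]⟩

theorem act_reflection (w : P ≃ₗ[ℤ] P) (hw : w ∈ D.weylGroup) :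
    (b.act w hw).reflection * w = w * b.reflection := by
  ext μ
  simp [reflection_apply, act]

/-- The real root `-β^∨`, with coroot `-β`. -/
def neg : D.RealRoot where
  root := -b.root
  coroot := -b.coroot
  exists_eq := by
    obtain ⟨v, hv, i, h1, h2⟩ := b.exists_eq
    refine ⟨v * D.simpleReflection i, mul_mem hv (D.simpleReflection_mem i), i, ?_, ?_⟩
    · rw [h1, weightAct_mul, weightAct_simpleReflection_simpleRoot, weightAct_neg]
    · rw [h2, LinearEquiv.mul_apply, simpleReflection_simpleCoroot, map_neg]

theorem neg_reflection : b.neg.reflection = b.reflection := by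
  ext μ
  simp [reflection_apply, neg]

end RealRoot

/-! ### Counting inversions -/

theorem inversionSet_mul_subset (hroot : LinearIndependent ℤ D.simpleRoot) {u v : P ≃ₗ[ℤ] P}
    (hu : u ∈ D.weylGroup) (hv : v ∈ D.weylGroup) :
    D.inversionSet (u * v) ⊆ D.inversionSet v ∪ weightAct v⁻¹ '' D.inversionSet u := by
  intro γ hγ
  rw [mem_inversionSet_iff hroot (mul_mem hu hv), weightAct_mul] at hγ
  obtain ⟨h1, h2, h3⟩ := hγ
  by_cases h : weightAct v γ ∈ D.rootCone
  · right
    refine ⟨weightAct v γ, ?_, weightAct_inv_self _ _⟩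
    exact (mem_inversionSet_iff hroot hu).2 ⟨D.weightAct_mem_realRoots hv h1, h, h3⟩
  · left
    exact (mem_inversionSet_iff hroot hv).2 ⟨h1, h2, h⟩

/-- Only the multiples of `αᵢ^∨` that are real roots can be inversions of `sᵢ`. Since a real root
pairs to `2` with its coroot, such a multiple divides `2`, which suffices for finiteness. -/
theorem finite_inversionSet_simpleReflection (hroot : LinearIndependent ℤ D.simpleRoot) (i : I) :
    (D.inversionSet (D.simpleReflection i)).Finite := by
  refine ((Set.finite_Icc (0 : ℤ) 2).image fun n => n • D.simpleRoot i).subset ?_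
  rintro γ ⟨⟨hγ, hpos⟩, -, hneg⟩
  obtain ⟨c, hc, rfl⟩ := D.exists_coeff_of_mem_rootCone hpos
  obtain ⟨d, hd, hdγ⟩ := D.exists_coeff_of_mem_rootCone hneg
  set γ := Finsupp.linearCombination ℤ D.simpleRoot c with hγdef
  have h : c + d = Finsupp.single i (γ (D.simpleCoroot i)) := by
    apply hroot
    rw [map_add, hdγ, ← hγdef, weightAct_simpleReflection, Finsupp.linearCombination_single]
    abel
  have hci : c = Finsupp.single i (c i) := by
    ext j
    by_cases hj : i = j
    · rw [hj, Finsupp.single_eq_same]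
    · have h1 := DFunLike.congr_fun h j
      have h2 := hc j
      have h3 := hd j
      rw [Finsupp.add_apply, Finsupp.single_eq_of_ne (Ne.symm hj)] at h1
      rw [Finsupp.single_eq_of_ne (Ne.symm hj)]
      simp only [Finsupp.coe_zero, Pi.zero_apply] at h2 h3
      omega
  have hγi : γ = c i • D.simpleRoot i := by
    rw [hγdef, hci, Finsupp.linearCombination_single, Finsupp.single_eq_same]
  refine ⟨c i, ⟨hc i, ?_⟩, hγi.symm⟩
  obtain ⟨b, hb⟩ := D.exists_realRoot hγ
  have h2 := b.pairing_self
  rw [hb, hγi, LinearMap.smul_apply, smul_eq_mul] at h2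
  exact Int.le_of_dvd (by norm_num) ⟨_, h2.symm⟩

theorem finite_inversionSet (hroot : LinearIndependent ℤ D.simpleRoot) {w : P ≃ₗ[ℤ] P}
    (hw : w ∈ D.weylGroup) : (D.inversionSet w).Finite := by
  have step : ∀ v ∈ D.weylGroup, ∀ i, (D.inversionSet v).Finite →
      (D.inversionSet (v * D.simpleReflection i)).Finite := fun v hv i h =>
    ((finite_inversionSet_simpleReflection hroot i).union (h.image _)).subset
      (inversionSet_mul_subset hroot hv (D.simpleReflection_mem i))
  induction hw using Subgroup.closure_induction_right with
  | one =>
    convert Set.finite_empty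
    ext γ
    simp only [mem_inversionSet_iff hroot (one_mem _), weightAct_one, Set.mem_empty_iff_false,
      iff_false]
    tauto
  | mul_right x hx y hy ih =>
    obtain ⟨i, rfl⟩ := hy
    exact step x hx i ih
  | mul_inv_cancel x hx y hy ih =>
    obtain ⟨i, rfl⟩ := hy
    rw [simpleReflection_inv]
    exact step x hx i ih

variable (D) in
/-- The number of inversions of `w`. -/
noncomputable def numInv (w : P ≃ₗ[ℤ] P) : ℕ := (D.inversionSet w).ncard

theorem numInv_mul_le (hroot : LinearIndependent ℤ D.simpleRoot) {u v : P ≃ₗ[ℤ] P}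
    (hu : u ∈ D.weylGroup) (hv : v ∈ D.weylGroup) :
    D.numInv (u * v) ≤ D.numInv v + D.numInv u := by
  refine (Set.ncard_le_ncard (inversionSet_mul_subset hroot hu hv)
    ((finite_inversionSet hroot hv).union ((finite_inversionSet hroot hu).image _))).trans ?_
  refine (Set.ncard_union_le _ _).trans ?_
  rw [Set.ncard_image_of_injective _ (weightAct_injective _)]
  rfl

/-- Counting the inversions `δ` of `w⁻¹ v` according to the sign of `v(δ)`. -/
theorem numInv_inv_mul_inv (hroot : LinearIndependent ℤ D.simpleRoot) {v w : P ≃ₗ[ℤ] P}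
    (hv : v ∈ D.weylGroup) (hw : w ∈ D.weylGroup) :
    D.numInv (w⁻¹ * v) = (D.inversionSet w⁻¹ \ D.inversionSet v⁻¹).ncard
      + (D.inversionSet v⁻¹ \ D.inversionSet w⁻¹).ncard := by
  have hv' := inv_mem hv
  have hw' := inv_mem hw
  have e1 : weightAct v '' (D.inversionSet (w⁻¹ * v) ∩ {δ | weightAct v δ ∈ D.rootCone})
      = D.inversionSet w⁻¹ \ D.inversionSet v⁻¹ := by
    ext γ
    simp only [Set.mem_image, Set.mem_inter_iff, Set.mem_sdiff, Set.mem_ofPred_eq,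
      mem_inversionSet_iff hroot (mul_mem hw' hv), mem_inversionSet_iff hroot hv',
      mem_inversionSet_iff hroot hw', weightAct_mul]
    constructor
    · rintro ⟨δ, ⟨⟨h1, h2, h3⟩, h4⟩, rfl⟩
      refine ⟨⟨D.weightAct_mem_realRoots hv h1, h4, h3⟩, ?_⟩
      rw [weightAct_inv_self]
      tauto
    · rintro ⟨⟨h1, h2, h3⟩, h4⟩
      refine ⟨weightAct v⁻¹ γ, ⟨⟨D.weightAct_mem_realRoots hv' h1, by tauto, ?_⟩, ?_⟩, ?_⟩
      · rwa [weightAct_self_inv]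
      · rwa [weightAct_self_inv]
      · exact weightAct_self_inv _ _
  have e2 : (fun δ => -weightAct v δ) ''
        (D.inversionSet (w⁻¹ * v) \ {δ | weightAct v δ ∈ D.rootCone})
      = D.inversionSet v⁻¹ \ D.inversionSet w⁻¹ := by
    ext γ
    simp only [Set.mem_image, Set.mem_sdiff, Set.mem_ofPred_eq,
      mem_inversionSet_iff hroot (mul_mem hw' hv), mem_inversionSet_iff hroot hv',
      mem_inversionSet_iff hroot hw', weightAct_mul]
    constructor
    · rintro ⟨δ, ⟨⟨h1, h2, h3⟩, h4⟩, rfl⟩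
      have h5 := D.weightAct_mem_realRoots hv h1
      have h6 := D.weightAct_mem_realRoots hw' h5
      refine ⟨⟨D.neg_mem_realRoots h5, (neg_mem_rootCone_iff hroot h5).2 h4, ?_⟩, ?_⟩
      · rw [weightAct_neg, weightAct_inv_self, neg_mem_rootCone_iff hroot h1]
        tauto
      · rw [weightAct_neg, neg_mem_rootCone_iff hroot h6]
        tauto
    · rintro ⟨⟨h1, h2, h3⟩, h4⟩
      have h5 := D.weightAct_mem_realRoots hv' h1
      have h6 := D.weightAct_mem_realRoots hw' h1
      refine ⟨-weightAct v⁻¹ γ, ⟨⟨D.neg_mem_realRoots h5,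
        (neg_mem_rootCone_iff hroot h5).2 h3, ?_⟩, ?_⟩, ?_⟩
      · rw [weightAct_neg, weightAct_self_inv, weightAct_neg, neg_mem_rootCone_iff hroot h6]
        tauto
      · rw [weightAct_neg, weightAct_self_inv, neg_mem_rootCone_iff hroot h1]
        tauto
      · simp
  rw [← e1, ← e2, Set.ncard_image_of_injective _ (weightAct_injective _),
    Set.ncard_image_of_injective _ fun _ _ h => weightAct_injective v (neg_injective h)]
  exact (Set.ncard_inter_add_ncard_sdiff_eq_ncard _ _
    (finite_inversionSet hroot (mul_mem hw' hv))).symm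

theorem numInv_inv (hroot : LinearIndependent ℤ D.simpleRoot) {w : P ≃ₗ[ℤ] P}
    (hw : w ∈ D.weylGroup) : D.numInv w⁻¹ = D.numInv w := by
  have h1 := numInv_inv_mul_inv hroot (one_mem D.weylGroup) hw
  have h2 := numInv_inv_mul_inv hroot hw (one_mem D.weylGroup)
  rw [mul_one] at h1
  rw [inv_one, one_mul] at h2
  rw [h1, h2, inv_one, add_comm]

/-- Multiplying by the reflection in a positive root `β^∨` with `w(β^∨)` positive adds inversions:
an inversion `δ` of `w` gives the inversion `s_β(δ)` of `w s_β` if `s_β(δ)` is positive, and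
remains an inversion of `w s_β` otherwise; the inversion `β^∨` is not obtained in this way. -/
theorem numInv_lt_mul_reflection (hroot : LinearIndependent ℤ D.simpleRoot) {w : P ≃ₗ[ℤ] P}
    (hw : w ∈ D.weylGroup) (b : D.RealRoot) (hb : b.root ∈ D.rootCone)
    (hwb : weightAct w b.root ∈ D.rootCone) : D.numInv w < D.numInv (w * b.reflection) := by
  classical
  have hmem : ∀ δ, δ ∈ D.inversionSet (w * b.reflection) ↔ _ := fun δ =>
    mem_inversionSet_iff hroot (mul_mem hw b.reflection_mem)
  have hwb' := D.weightAct_mem_realRoots hw b.root_mem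
  have hbinv : b.root ∈ D.inversionSet (w * b.reflection) := by
    rw [hmem, weightAct_mul, b.weightAct_reflection_root, weightAct_neg,
      neg_mem_rootCone_iff hroot hwb']
    exact ⟨b.root_mem, hb, not_not.2 hwb⟩
  have hfin := finite_inversionSet hroot (mul_mem hw b.reflection_mem)
  have hinvol : ∀ δ, weightAct b.reflection (weightAct b.reflection δ) = δ := by
    intro δ
    rw [← weightAct_mul, b.reflection_mul_self, weightAct_one]
  let f : Module.Dual ℤ P → Module.Dual ℤ P := fun δ =>
    if weightAct b.reflection δ ∈ D.rootCone then weightAct b.reflection δ else δ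
  refine lt_of_le_of_lt (Set.ncard_le_ncard_of_injOn f ?_ ?_ (hfin.sdiff (t := {b.root})))
    (Set.ncard_sdiff_singleton_lt_of_mem hbinv hfin)
  · intro δ hδ
    obtain ⟨h1, h2, h3⟩ := (mem_inversionSet_iff hroot hw).1 hδ
    have h4 := D.weightAct_mem_realRoots b.reflection_mem h1
    rw [Set.mem_sdiff, hmem, Set.mem_singleton_iff, weightAct_mul]
    by_cases h : weightAct b.reflection δ ∈ D.rootCone
    · simp only [f, h, if_true, hinvol]
      refine ⟨⟨h4, trivial, h3⟩, fun e => ?_⟩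
      have e' : δ = -b.root := by
        rw [← hinvol δ, e, b.weightAct_reflection_root]
      rw [e', neg_mem_rootCone_iff hroot b.root_mem] at h2
      exact h2 hb
    · simp only [f, h, if_false]
      refine ⟨⟨h1, h2, ?_⟩, ?_⟩
      · -- `s_β(δ) = δ - ⟨β, δ⟩ β^∨` can only be negative if `⟨β, δ⟩ > 0`.
        have hpair : 0 ≤ δ b.coroot := by
          by_contra hlt
          apply h
          rw [b.weightAct_reflection, sub_eq_add_neg, ← neg_smul]
          exact add_mem h2 (zsmul_mem_of_nonneg _ hb (by omega))
        rw [← neg_mem_rootCone_iff hroot (D.weightAct_mem_realRoots hw h4), b.weightAct_reflection,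
          weightAct_sub, weightAct_smul, neg_sub, sub_eq_add_neg]
        exact add_mem (zsmul_mem_of_nonneg _ hwb hpair)
          ((neg_mem_rootCone_iff hroot (D.weightAct_mem_realRoots hw h1)).2 h3)
      · rintro rfl
        exact h3 hwb
  · intro δ₁ h₁ δ₂ h₂ e
    have p1 := ((mem_inversionSet_iff hroot hw).1 h₁).2.1
    have p2 := ((mem_inversionSet_iff hroot hw).1 h₂).2.1
    by_cases c1 : weightAct b.reflection δ₁ ∈ D.rootCone <;>
      by_cases c2 : weightAct b.reflection δ₂ ∈ D.rootCone
    · simp only [f, c1, c2, if_true] at e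
      exact weightAct_injective _ e
    · simp only [f, c1, c2, if_true, if_false] at e
      rw [← e, hinvol] at c2
      exact absurd p1 c2
    · simp only [f, c1, c2, if_true, if_false] at e
      rw [e, hinvol] at c1
      exact absurd p2 c1
    · simpa only [f, c1, c2, if_false] using e

theorem numInv_lt_reflection_mul (hroot : LinearIndependent ℤ D.simpleRoot) {w : P ≃ₗ[ℤ] P}
    (hw : w ∈ D.weylGroup) (b : D.RealRoot) (hb : b.root ∈ D.rootCone)
    (hwb : weightAct w⁻¹ b.root ∈ D.rootCone) : D.numInv w < D.numInv (b.reflection * w) := by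
  have h := numInv_lt_mul_reflection hroot (inv_mem hw) b hb hwb
  rwa [numInv_inv hroot hw, ← b.reflection_inv, ← mul_inv_rev,
    numInv_inv hroot (mul_mem b.reflection_mem hw)] at h

theorem numInv_reflection_mul_lt (hroot : LinearIndependent ℤ D.simpleRoot) {w : P ≃ₗ[ℤ] P}
    (hw : w ∈ D.weylGroup) (b : D.RealRoot) (hb : b.root ∈ D.rootCone)
    (hwb : weightAct w⁻¹ b.root ∉ D.rootCone) : D.numInv (b.reflection * w) < D.numInv w := by
  have h := numInv_lt_reflection_mul hroot (mul_mem b.reflection_mem hw) b hb (by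
    rwa [mul_inv_rev, b.reflection_inv, weightAct_mul, b.weightAct_reflection_root, weightAct_neg,
      neg_mem_rootCone_iff hroot (D.weightAct_mem_realRoots (inv_mem hw) b.root_mem)])
  rwa [← mul_assoc, b.reflection_mul_self, one_mul] at h

/-! ### The small length -/

variable (D) in
/-- The small length of `π^μ w`, as a function of `μ` and `w`. -/
noncomputable def signedLength (μ : P) (w : P ≃ₗ[ℤ] P) : ℤ :=
  ({γ | γ ∈ D.inversionSet w⁻¹ ∧ 0 ≤ γ μ}.ncard : ℤ)
    - ({γ | γ ∈ D.inversionSet w⁻¹ ∧ γ μ < 0}.ncard : ℤ)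

variable (D) in
/-- `v` has the inversions prescribed by `μ`: the positive real roots that `v⁻¹` makes negative are
those on which `μ` is negative. For `μ` in the Tits cone this singles out the shortest `v` in the
Weyl group such that `v⁻¹(μ)` is dominant. -/
def IsMinimalFor (μ : P) (v : P ≃ₗ[ℤ] P) : Prop :=
  ∀ γ ∈ D.realRoots, γ ∈ D.rootCone → (γ μ < 0 ↔ weightAct v⁻¹ γ ∉ D.rootCone)

theorem nonneg_of_mem_rootCone {μ : P} (hμ : μ ∈ D.dominantCone) {f : Module.Dual ℤ P}
    (hf : f ∈ D.rootCone) : 0 ≤ f μ := by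
  induction hf using AddSubmonoid.closure_induction with
  | mem x hx =>
    obtain ⟨i, rfl⟩ := hx
    exact hμ i
  | zero => exact le_rfl
  | add x y _ _ hx hy => exact add_nonneg hx hy

theorem exists_isMinimalFor (hroot : LinearIndependent ℤ D.simpleRoot) {ν : P}
    (hν : ν ∈ D.dominantCone) {u : P ≃ₗ[ℤ] P} (hu : u ∈ D.weylGroup) :
    ∃ v ∈ D.weylGroup, v ν = u ν ∧ D.IsMinimalFor (u ν) v := by
  classical
  have hne : ∃ n, ∃ v ∈ D.weylGroup, v ν = u ν ∧ D.numInv v = n := ⟨_, u, hu, rfl, rfl⟩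
  obtain ⟨v, hv, hvν, hvn⟩ := Nat.find_spec hne
  have hmin : ∀ v' ∈ D.weylGroup, v' ν = u ν → D.numInv v ≤ D.numInv v' := by
    intro v' hv' h
    rw [hvn]
    exact Nat.find_min' hne ⟨v', hv', h, rfl⟩
  refine ⟨v, hv, hvν, fun γ hγ hpos => ?_⟩
  obtain ⟨b, rfl⟩ := D.exists_realRoot hγ
  have e : b.root (u ν) = weightAct v⁻¹ b.root ν := by
    rw [weightAct_apply, inv_inv, hvν]
  constructor
  · intro h h'
    have := nonneg_of_mem_rootCone hν h'
    omega
  · intro h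
    have h1 := nonneg_of_mem_rootCone hν
      ((neg_mem_rootCone_iff hroot (D.weightAct_mem_realRoots (inv_mem hv) hγ)).2 h)
    rw [LinearMap.neg_apply, ← e] at h1
    refine lt_of_le_of_ne (by omega) fun h0 => ?_
    -- If `⟨μ, γ⟩ = 0` then `s_γ v` is a shorter choice than `v`.
    refine absurd (hmin (b.reflection * v) (mul_mem b.reflection_mem hv) ?_)
      (not_le.2 (numInv_reflection_mul_lt hroot hv b hpos h))
    rw [LinearEquiv.mul_apply, b.reflection_apply, hvν, h0, zero_smul, sub_zero]

theorem signedLength_eq (hroot : LinearIndependent ℤ D.simpleRoot) {μ : P} {v w : P ≃ₗ[ℤ] P}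
    (hv : v ∈ D.weylGroup) (hw : w ∈ D.weylGroup) (hμ : D.IsMinimalFor μ v) :
    D.signedLength μ w = D.numInv (v⁻¹ * w) - D.numInv v := by
  have e1 : {γ | γ ∈ D.inversionSet w⁻¹ ∧ 0 ≤ γ μ}
      = D.inversionSet w⁻¹ \ D.inversionSet v⁻¹ := by
    ext γ
    simp only [Set.mem_ofPred_eq, Set.mem_sdiff, mem_inversionSet_iff hroot (inv_mem hv),
      mem_inversionSet_iff hroot (inv_mem hw)]
    constructor
    · rintro ⟨⟨h1, h2, h3⟩, h4⟩
      exact ⟨⟨h1, h2, h3⟩, fun h => not_lt.2 h4 ((hμ γ h1 h2).2 h.2.2)⟩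
    · rintro ⟨⟨h1, h2, h3⟩, h4⟩
      exact ⟨⟨h1, h2, h3⟩, not_lt.1 fun h => h4 ⟨h1, h2, (hμ γ h1 h2).1 h⟩⟩
  have e2 : {γ | γ ∈ D.inversionSet w⁻¹ ∧ γ μ < 0}
      = D.inversionSet v⁻¹ ∩ D.inversionSet w⁻¹ := by
    ext γ
    simp only [Set.mem_ofPred_eq, Set.mem_inter_iff, mem_inversionSet_iff hroot (inv_mem hv),
      mem_inversionSet_iff hroot (inv_mem hw)]
    constructor
    · rintro ⟨⟨h1, h2, h3⟩, h4⟩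
      exact ⟨⟨h1, h2, (hμ γ h1 h2).1 h4⟩, h1, h2, h3⟩
    · rintro ⟨⟨h1, h2, h3⟩, h4⟩
      exact ⟨h4, (hμ γ h1 h2).2 h3⟩
  have h1 := numInv_inv_mul_inv hroot hv hw
  have h2 := Set.ncard_inter_add_ncard_sdiff_eq_ncard (D.inversionSet v⁻¹) (D.inversionSet w⁻¹)
    (finite_inversionSet hroot (inv_mem hv))
  have h3 : (D.inversionSet v⁻¹).ncard = D.numInv v := numInv_inv hroot hv
  have h4 : D.numInv (w⁻¹ * v) = D.numInv (v⁻¹ * w) := by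
    rw [← numInv_inv hroot (mul_mem (inv_mem hv) hw), mul_inv_rev, inv_inv]
  rw [signedLength, e1, e2]
  omega

/-- Inversion numbers add up along `v u` if `v` is minimal for a coweight `v(ν)`, with `ν`
dominant, and `u` stabilizes `ν`. -/
theorem numInv_mul_of_isMinimalFor (hroot : LinearIndependent ℤ D.simpleRoot) {ν : P}
    (hν : ν ∈ D.dominantCone) {v u : P ≃ₗ[ℤ] P} (hv : v ∈ D.weylGroup) (hu : u ∈ D.weylGroup)
    (huν : u ν = ν) (hmin : D.IsMinimalFor (v ν) v) :
    D.numInv (v * u) = D.numInv v + D.numInv u := by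
  have hvu := mul_mem hv hu
  have hsub : D.inversionSet v⁻¹ ⊆ D.inversionSet (v * u)⁻¹ := by
    intro γ hγ
    rw [mem_inversionSet_iff hroot (inv_mem hv)] at hγ
    rw [mem_inversionSet_iff hroot (inv_mem hvu)]
    refine ⟨hγ.1, hγ.2.1, fun h => ?_⟩
    have h1 := nonneg_of_mem_rootCone hν h
    rw [weightAct_apply, inv_inv, LinearEquiv.mul_apply, huν] at h1
    have h2 := (hmin γ hγ.1 hγ.2.1).2 hγ.2.2
    omega
  have h1 := numInv_inv_mul_inv hroot hv hvu
  rw [Set.sdiff_eq_empty.2 hsub, Set.ncard_empty, add_zero,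
    Set.ncard_sdiff hsub (finite_inversionSet hroot (inv_mem hv))] at h1
  have h2 := Set.ncard_le_ncard hsub (finite_inversionSet hroot (inv_mem hvu))
  have h3 : (D.inversionSet v⁻¹).ncard = D.numInv v := numInv_inv hroot hv
  have h4 : (D.inversionSet (v * u)⁻¹).ncard = D.numInv (v * u) := numInv_inv hroot hvu
  have h5 : (v * u)⁻¹ * v = u⁻¹ := by group
  rw [h5, numInv_inv hroot hu] at h1
  omega

/-- The effect on the small length of multiplying by a reflection on the right, that is, of
passing from `π^μ w` to `π^μ s_γ w`. -/
theorem signedLength_reflection_mul (hroot : LinearIndependent ℤ D.simpleRoot) {μ : P}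
    (hμ : μ ∈ D.titsCone) {w : P ≃ₗ[ℤ] P} (hw : w ∈ D.weylGroup) (b : D.RealRoot)
    (hb : b.root ∈ D.rootCone) (hwb : weightAct w⁻¹ b.root ∈ D.rootCone) :
    (0 ≤ b.root μ → D.signedLength μ w < D.signedLength μ (b.reflection * w)) ∧
      (b.root μ < 0 → D.signedLength μ (b.reflection * w) < D.signedLength μ w) := by
  obtain ⟨u, hu, ν, hν, rfl⟩ := hμ
  obtain ⟨v, hv, -, hmin⟩ := exists_isMinimalFor hroot hν hu
  have hv' := inv_mem hv
  have hvw := mul_mem hv' hw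
  rw [signedLength_eq hroot hv hw hmin,
    signedLength_eq hroot hv (mul_mem b.reflection_mem hw) hmin]
  have e : v⁻¹ * (b.reflection * w) = (b.act v⁻¹ hv').reflection * (v⁻¹ * w) := by
    rw [← mul_assoc, ← mul_assoc, b.act_reflection]
  have hact : weightAct (v⁻¹ * w)⁻¹ (b.act v⁻¹ hv').root = weightAct w⁻¹ b.root := by
    simp [RealRoot.act, weightAct_mul]
  have hsign := hmin b.root b.root_mem hb
  have hwb' := D.weightAct_mem_realRoots (inv_mem hw) b.root_mem
  rw [e]
  constructor
  · intro h
    have := numInv_lt_reflection_mul hroot hvw (b.act v⁻¹ hv')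
      (not_not.1 fun h' => not_lt.2 h (hsign.2 h')) (by rwa [hact])
    omega
  · intro h
    have := numInv_reflection_mul_lt hroot hvw (b.act v⁻¹ hv').neg
      ((neg_mem_rootCone_iff hroot (D.weightAct_mem_realRoots hv' b.root_mem)).2 (hsign.1 h))
      (by
        change weightAct _ (-(b.act v⁻¹ hv').root) ∉ _
        rw [weightAct_neg, hact, neg_mem_rootCone_iff hroot hwb']
        exact not_not.2 hwb)
    rw [RealRoot.neg_reflection] at this
    omega

/-- Reflecting `π^μ w` to `π^(s_γ μ) s_γ w` increases the small length if `⟨μ, γ⟩ < 0`. If `v` and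
`v'` are minimal for `μ` and `s_γ(μ)`, then `u = v'⁻¹ s_γ v` fixes the dominant coweight in the
orbit, and the gain `ℓ(v) - ℓ(v')` exceeds `ℓ(u)`, the largest possible loss. -/
theorem signedLength_lt_reflection (hroot : LinearIndependent ℤ D.simpleRoot) {μ : P}
    (hμ : μ ∈ D.titsCone) {w : P ≃ₗ[ℤ] P} (hw : w ∈ D.weylGroup) (b : D.RealRoot)
    (hb : b.root ∈ D.rootCone) (hneg : b.root μ < 0) :
    D.signedLength μ w < D.signedLength (b.reflection μ) (b.reflection * w) := by
  obtain ⟨u₀, hu₀, ν, hν, rfl⟩ := hμ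
  obtain ⟨v, hv, hvν, hmin⟩ := exists_isMinimalFor hroot hν hu₀
  have hs := b.reflection_mem
  obtain ⟨v', hv', hv'ν, hmin'⟩ := exists_isMinimalFor hroot hν (mul_mem hs hu₀)
  rw [LinearEquiv.mul_apply] at hv'ν hmin'
  rw [signedLength_eq hroot hv hw hmin, signedLength_eq hroot hv' (mul_mem hs hw) hmin']
  set u := v'⁻¹ * (b.reflection * v) with hu
  have huW : u ∈ D.weylGroup := mul_mem (inv_mem hv') (mul_mem hs hv)
  have huν : u ν = ν := by
    rw [hu, LinearEquiv.mul_apply, LinearEquiv.mul_apply, hvν, ← hv'ν, ← LinearEquiv.mul_apply,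
      inv_mul_cancel, LinearEquiv.coe_one, id]
  have h1 := numInv_mul_of_isMinimalFor hroot hν hv' huW huν (by rwa [hv'ν])
  rw [hu, mul_inv_cancel_left, ← hu] at h1
  have h2 := numInv_reflection_mul_lt hroot hv b hb ((hmin _ b.root_mem hb).1 hneg)
  have h3 := numInv_mul_le hroot (inv_mem huW)
    (mul_mem huW (mul_mem (inv_mem hv) hw))
  rw [inv_mul_cancel_left, numInv_inv hroot huW] at h3
  have h4 : v'⁻¹ * (b.reflection * w) = u * (v⁻¹ * w) := by
    rw [hu]
    group
  rw [h4]
  omega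

/-! ### The big length -/

theorem corootCone_height {ρ : Module.Dual ℤ P} (hρ : ∀ i, ρ (D.simpleCoroot i) = 1) {x : P}
    (hx : x ∈ D.corootCone) : 0 ≤ ρ x ∧ (ρ x = 0 → x = 0) := by
  induction hx using AddSubmonoid.closure_induction with
  | mem x hx =>
    obtain ⟨i, rfl⟩ := hx
    simp [hρ]
  | zero => simp
  | add x y _ _ hx hy =>
    rw [map_add]
    refine ⟨add_nonneg hx.1 hy.1, fun h => ?_⟩
    rw [hx.2 (by linarith [hx.1, hy.1]), hy.2 (by linarith [hx.1, hy.1]), add_zero]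

theorem height_le_dominantRep {ρ : Module.Dual ℤ P} (hρ : ∀ i, ρ (D.simpleCoroot i) = 1) {μ : P}
    (h : μ ∈ D.titsCone) {w : P ≃ₗ[ℤ] P} (hw : w ∈ D.weylGroup) :
    ρ (w μ) ≤ ρ (D.dominantRep h) ∧ (ρ (w μ) = ρ (D.dominantRep h) → w μ = D.dominantRep h) := by
  obtain ⟨hv, hdom⟩ := (D.exists_dominant h).choose_spec
  set v := (D.exists_dominant h).choose
  have e : D.dominantRep h = v μ := rfl
  have h1 := D.sub_apply_mem_corootCone hdom (mul_mem hw (inv_mem hv))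
  rw [LinearEquiv.mul_apply, ← LinearEquiv.mul_apply v⁻¹, inv_mul_cancel, LinearEquiv.coe_one,
    id] at h1
  have h2 := corootCone_height hρ h1
  rw [map_sub] at h2
  rw [e]
  refine ⟨by linarith [h2.1], fun h3 => ?_⟩
  exact (sub_eq_zero.1 (h2.2 (by linarith))).symm

theorem exists_dominantRep_eq {μ : P} (h : μ ∈ D.titsCone) :
    ∃ w ∈ D.weylGroup, D.dominantRep h = w μ :=
  ⟨_, (D.exists_dominant h).choose_spec.1, rfl⟩

theorem height_dominantRep_congr {ρ : Module.Dual ℤ P} (hρ : ∀ i, ρ (D.simpleCoroot i) = 1)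
    {μ μ' : P} (h : μ ∈ D.titsCone) (h' : μ' ∈ D.titsCone) {w : P ≃ₗ[ℤ] P}
    (hw : w ∈ D.weylGroup) (e : μ' = w μ) : ρ (D.dominantRep h') = ρ (D.dominantRep h) := by
  subst e
  obtain ⟨v, hv, hve⟩ := exists_dominantRep_eq h
  obtain ⟨v', hv', hve'⟩ := exists_dominantRep_eq h'
  apply le_antisymm
  · rw [hve', ← LinearEquiv.mul_apply]
    exact (height_le_dominantRep hρ h (mul_mem hv' hw)).1
  · have h1 := (height_le_dominantRep hρ h' (mul_mem hv (inv_mem hw))).1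
    rwa [LinearEquiv.mul_apply, ← LinearEquiv.mul_apply w⁻¹, inv_mul_cancel, LinearEquiv.coe_one,
      id, ← hve] at h1

/-- Strict convexity of the height: a coweight strictly between `μ` and `s_β(μ)` on the `β`-line
has a lower dominant representative. -/
theorem height_dominantRep_lt {ρ : Module.Dual ℤ P} (hρ : ∀ i, ρ (D.simpleCoroot i) = 1)
    {μ μ' : P} (h : μ ∈ D.titsCone) (h' : μ' ∈ D.titsCone) (b : D.RealRoot) {n : ℤ}
    (e : μ' = μ + n • b.coroot) (hn : n * (n + b.root μ) < 0) :
    ρ (D.dominantRep h') < ρ (D.dominantRep h) := by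
  obtain ⟨w, hw, hwe⟩ := exists_dominantRep_eq h'
  obtain ⟨h1, h1'⟩ := height_le_dominantRep hρ h hw
  obtain ⟨h2, h2'⟩ := height_le_dominantRep hρ h (mul_mem hw b.reflection_mem)
  set R := ρ (D.dominantRep h)
  set k := b.root μ with hk
  have e2 : ρ ((w * b.reflection) μ) = ρ (w μ) - k * ρ (w b.coroot) := by
    rw [LinearEquiv.mul_apply, b.reflection_apply]
    simp [hk]
  have e3 : ρ (D.dominantRep h') = ρ (w μ) + n * ρ (w b.coroot) := by
    rw [hwe, e]
    simp
  -- If both ends had maximal height they would coincide after applying `w`.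
  have hne : ρ (w μ) < R ∨ ρ ((w * b.reflection) μ) < R := by
    by_contra hcon
    push Not at hcon
    have e4 := (h1' (le_antisymm h1 hcon.1)).trans (h2' (le_antisymm h2 hcon.2)).symm
    rw [LinearEquiv.mul_apply] at e4
    have e5 := congrArg b.root (w.injective e4)
    rw [b.reflection_apply, map_sub, map_smul, b.pairing_self, ← hk, smul_eq_mul] at e5
    have hk0 : k = 0 := by omega
    rw [hk0] at hn
    nlinarith [mul_self_nonneg n]
  rw [e2] at h2 hne
  rw [e3]
  set x := ρ (w μ)
  set t := ρ (w b.coroot)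
  rcases lt_or_gt_of_ne (show n ≠ 0 by rintro rfl; simp at hn) with hn0 | hn0
  · have hnk : 0 < n + k := by nlinarith
    by_contra hcon
    rcases hne with h3 | h3 <;> nlinarith
  · have hnk : n + k < 0 := by nlinarith
    by_contra hcon
    rcases hne with h3 | h3 <;> nlinarith

/-! ### Comparison of the two orders -/

theorem length_lt_iff (ρ : Module.Dual ℤ P) (y x : D.WT) :
    D.length ρ y < D.length ρ x ↔ D.bigLength ρ y < D.bigLength ρ x ∨
      (D.bigLength ρ y = D.bigLength ρ x ∧ D.smallLength y < D.smallLength x) :=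
  Prod.Lex.toLex_lt_toLex

/-- For a positive double affine root `b = β^∨ + nπ`, the root `y(b)` is positive exactly if
`y s_b` is longer than `y`. -/
theorem isPosDoubleAffineRoot_affineAct_iff (hroot : LinearIndependent ℤ D.simpleRoot)
    {ρ : Module.Dual ℤ P} (hρ : ∀ i, ρ (D.simpleCoroot i) = 1) {y x : D.WT} {b : D.RealRoot}
    {n : ℤ} (hb : D.IsPosDoubleAffineRoot (b.root, n))
    (hx : x.1 = y.1 * D.doubleAffineReflection b n) :
    D.IsPosDoubleAffineRoot (D.affineAct y.1 (b.root, n)) ↔ D.length ρ y < D.length ρ x := by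
  have hμ : D.translation y.1 ∈ D.titsCone := y.2
  have hμ' : D.translation x.1 ∈ D.titsCone := x.2
  have hw : D.weylPart y.1 ∈ D.weylGroup := y.1.right.2
  have hbigy : D.bigLength ρ y = 2 * ρ (D.dominantRep hμ) := rfl
  have hbigx : D.bigLength ρ x = 2 * ρ (D.dominantRep hμ') := rfl
  have hsmally : D.smallLength y = D.signedLength (D.translation y.1) (D.weylPart y.1) := rfl
  have hsmallx : D.smallLength x = D.signedLength (D.translation x.1) (D.weylPart x.1) := rfl
  have htr : D.translation x.1 = D.translation y.1 + n • (b.act _ hw).coroot := by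
    rw [hx, RealRoot.act, ← map_zsmul]
    rfl
  have hwp : D.weylPart x.1 = (b.act _ hw).reflection * D.weylPart y.1 := by
    rw [RealRoot.act_reflection, hx]
    rfl
  have haff : D.affineAct y.1 (b.root, n)
      = ((b.act _ hw).root, n + (b.act _ hw).root (D.translation y.1)) := rfl
  rw [length_lt_iff, haff, hbigy, hbigx, hsmally, hsmallx, hwp]
  have hwg : weightAct (D.weylPart y.1)⁻¹ (b.act _ hw).root = b.root := weightAct_inv_self _ _
  clear hbigx hbigy hsmally hsmallx haff hwp hx
  generalize b.act _ hw = g at *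
  generalize D.translation x.1 = μ' at *
  generalize D.translation y.1 = μ at *
  generalize D.weylPart y.1 = w at *
  have hgpos : g.root ∈ D.posRealRoots ↔ g.root ∈ D.rootCone := mem_posRealRoots_iff g.root_mem
  have hgneg : g.root ∈ D.negRealRoots ↔ g.root ∉ D.rootCone :=
    mem_negRealRoots_iff hroot g.root_mem
  have hn : 0 ≤ n := by
    rcases hb with h | h
    · exact h.2
    · exact h.2.le
  have hs := g.reflection_mem
  simp only [IsPosDoubleAffineRoot, hgpos, hgneg]
  rcases hn.eq_or_lt with hn0 | hn0
  · -- The translation part does not change.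
    subst hn0
    obtain rfl : μ' = μ := by rw [htr, zero_smul, add_zero]
    have hbpos : b.root ∈ D.rootCone := by
      rcases hb with h | h
      · exact h.1.2
      · exact absurd h.2 (lt_irrefl _)
    simp only [lt_irrefl, true_and, false_or, zero_add]
    by_cases hg : g.root ∈ D.rootCone
    · obtain ⟨h1, h2⟩ := signedLength_reflection_mul hroot hμ hw g hg (by rwa [hwg])
      simp only [hg, true_and, not_true_eq_false, false_and, or_false]
      refine ⟨h1, fun h => ?_⟩
      by_contra h'
      exact lt_asymm h (h2 (not_le.1 h'))
    · obtain ⟨h1, h2⟩ := signedLength_reflection_mul hroot hμ (mul_mem hs hw) g.neg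
        ((neg_mem_rootCone_iff hroot g.root_mem).2 hg) (by
          rw [mul_inv_rev, g.reflection_inv, weightAct_mul]
          change weightAct _ (weightAct _ (-g.root)) ∈ _
          rwa [weightAct_neg, g.weightAct_reflection_root, neg_neg, hwg])
      rw [g.neg_reflection, ← mul_assoc, g.reflection_mul_self, one_mul] at h1 h2
      have e : g.neg.root μ' = -g.root μ' := rfl
      rw [e] at h1 h2
      simp only [hg, false_and, not_false_eq_true, true_and, false_or]
      refine ⟨fun h => h2 (by omega), fun h => ?_⟩
      by_contra h'
      exact lt_asymm h (h1 (by omega))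
  rcases lt_trichotomy (n + g.root μ) 0 with hm | hm | hm
  · -- The new translation part lies strictly between `μ` and `s_γ(μ)`.
    have h := height_dominantRep_lt hρ hμ hμ' g htr (mul_neg_of_pos_of_neg hn0 hm)
    constructor
    · rintro (h1 | h1) <;> omega
    · rintro (h1 | h1) <;> omega
  · -- The new translation part is `s_γ(μ)`.
    have hμs : μ' = g.reflection μ := by
      rw [htr, g.reflection_apply, show n = -g.root μ by omega]
      module
    have h := height_dominantRep_congr hρ hμ hμ' hs hμs
    simp only [h, lt_irrefl, true_and, false_or, hm, le_refl, and_true, and_false, or_false]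
    rw [hμs]
    by_cases hg : g.root ∈ D.rootCone
    · simp only [hg, true_iff]
      exact signedLength_lt_reflection hroot hμ hw g hg (by omega)
    · simp only [hg, false_iff]
      have h1 := signedLength_lt_reflection hroot hμ' (mul_mem hs hw) g.neg
        ((neg_mem_rootCone_iff hroot g.root_mem).2 hg) (by
          change -g.root μ' < 0
          rw [hμs, g.reflection_apply, map_sub, map_smul, g.pairing_self, smul_eq_mul]
          omega)
      rw [g.neg_reflection, hμs, ← mul_assoc, g.reflection_mul_self, one_mul,
        ← LinearEquiv.mul_apply, g.reflection_mul_self, LinearEquiv.coe_one, id] at h1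
      exact lt_asymm h1
  · -- Now `μ` lies strictly between the new translation part and its reflection.
    have h := height_dominantRep_lt hρ hμ' hμ g (n := -n) (by rw [htr]; module) (by
      rw [htr, map_add, map_smul, g.pairing_self, smul_eq_mul]
      nlinarith [mul_pos hn0 hm])
    refine iff_of_true ?_ (Or.inl (by omega))
    by_cases hg : g.root ∈ D.rootCone
    · exact Or.inl ⟨hg, hm.le⟩
    · exact Or.inr ⟨hg, hm⟩

theorem length_lt_or_eq_of_secondBruhatLE {ρ : Module.Dual ℤ P} {x y : D.WT}
    (h : D.SecondBruhatLE ρ x y) : x = y ∨ D.length ρ x < D.length ρ y := by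
  induction h with
  | refl => exact Or.inl rfl
  | tail _ hstep ih =>
    obtain ⟨_, _, -, -, hlt⟩ := hstep
    rcases ih with rfl | h
    · exact Or.inr hlt
    · exact Or.inr (h.trans hlt)

end KacMoodyRootDatum

theorem theorem4 {P : Type*} [AddCommGroup P] [Module.Free ℤ P] [Module.Finite ℤ P]
    {I : Type*} [Fintype I] [DecidableEq I] (D : KacMoodyRootDatum P I)
    (hroot : LinearIndependent ℤ D.simpleRoot)
    (Λ : I → Module.Dual ℤ P)
    (hΛ : ∀ i j, Λ i (D.simpleCoroot j) = if i = j then 1 else 0) :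
    (∀ x y : D.WT,
      D.FirstBruhatLE x y ↔ D.SecondBruhatLE (KacMoodyRootDatum.rho Λ) x y) ∧
    IsPartialOrder D.WT D.FirstBruhatLE := by
  have hρ : ∀ i, KacMoodyRootDatum.rho Λ (D.simpleCoroot i) = 1 := by
    intro i
    simp [KacMoodyRootDatum.rho, LinearMap.sum_apply, hΛ]
  have hstep : D.FirstStep = D.SecondStep (KacMoodyRootDatum.rho Λ) := by
    ext y x
    constructor
    · rintro ⟨b, n, hb, hx, hpos⟩
      exact ⟨b, n, hb, hx,
        (KacMoodyRootDatum.isPosDoubleAffineRoot_affineAct_iff hroot hρ hb hx).1 hpos⟩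
    · rintro ⟨b, n, hb, hx, hlt⟩
      exact ⟨b, n, hb, hx,
        (KacMoodyRootDatum.isPosDoubleAffineRoot_affineAct_iff hroot hρ hb hx).2 hlt⟩
  have hle : D.FirstBruhatLE = D.SecondBruhatLE (KacMoodyRootDatum.rho Λ) :=
    congrArg Relation.ReflTransGen hstep
  refine ⟨fun x y => by rw [hle], ?_⟩
  exact
    { refl := fun _ => Relation.ReflTransGen.refl
      trans := fun _ _ _ => Relation.ReflTransGen.trans
      antisymm := fun x y hxy hyx => by
        rw [hle] at hxy hyx
        rcases KacMoodyRootDatum.length_lt_or_eq_of_secondBruhatLE hxy with h | h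
        · exact h
        rcases KacMoodyRootDatum.length_lt_or_eq_of_secondBruhatLE hyx with h' | h'
        · exact h'.symm
        · exact absurd h (lt_asymm h') }
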